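/- Let $(G,u)$ be a unital $\ell$-group: $G$ is a (not necessarily commutative) lattice-ordered group, written additively, and $u\ge 0$ is a strong unit, i.e. for each $g\in G$ there is an integer $n\ge 1$ with $g\le nu$. Let $M=\Gamma(G,u)$ be the pseudo MV-algebra $([0,u];\oplus,{}^-,{}^\sim,0,u)$, where $x\oplus y=(x+y)\wedge u$, $x^-=u-x$, $x^\sim=-x+u$, and put $x\odot y=(y^-\oplus x^-)^\sim=(x-u+y)\vee 0$. Assume that $M$ is representable (a subdirect product of linearly ordered pseudo MV-algebras) and symmetric ($x^-=x^\sim$ for all $x\in M$). Let $r:M\to M$ be a strict square root on $M$, that is, for all $x,y\in M$: 1. $r(x)\odot r(x)=x$; 2. $y\odot y\le x$ implies $y\le r(x)$; 3. $r(x^-)=r(x)^-\oplus r(0)$ and $r(x^\sim)=r(0)\oplus r(x)^\sim$; 4. (strictness) $r(0)=r(0)^-$. Then for each $x\in M$ the element $(x+u)/2$ exists in $G$, i.e. there is a unique $h\in G$ with $h+h=x+u$, and $$r(x)=\frac{x+u}{2},$$ where $+$ is the group addition of $G$. -/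

import Mathlib

/-- The operations of a pseudo MV-algebra: `oplus x y` is `x ⊕ y`, `minus x` is `x⁻`,
`tilde x` is `x^∼`. -/
class PseudoMVOps (M : Type*) where
  oplus : M → M → M
  minus : M → M
  tilde : M → M
  zero : M
  one : M

namespace PseudoMVOps

infixl:65 " ⊕ₘ " => PseudoMVOps.oplus

/-- `x ⊙ y = (y⁻ ⊕ x⁻)^∼`. -/
def odot {M : Type*} [PseudoMVOps M] (x y : M) : M := tilde (minus y ⊕ₘ minus x)

infixl:70 " ⊙ₘ " => PseudoMVOps.odot

end PseudoMVOps

open PseudoMVOps in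
/-- Pseudo MV-algebras. -/
class PseudoMVAlgebra (M : Type*) extends PseudoMVOps M where
  oplus_assoc : ∀ x y z : M, x ⊕ₘ (y ⊕ₘ z) = (x ⊕ₘ y) ⊕ₘ z
  oplus_zero : ∀ x : M, x ⊕ₘ zero = x
  zero_oplus : ∀ x : M, zero ⊕ₘ x = x
  oplus_one : ∀ x : M, x ⊕ₘ one = one
  one_oplus : ∀ x : M, one ⊕ₘ x = one
  minus_one : minus (one : M) = zero
  tilde_one : tilde (one : M) = zero
  tilde_minus_oplus_minus : ∀ x y : M, tilde (minus x ⊕ₘ minus y) = minus (tilde x ⊕ₘ tilde y)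
  sup_eq₁ : ∀ x y : M, x ⊕ₘ (tilde x ⊙ₘ y) = y ⊕ₘ (tilde y ⊙ₘ x)
  sup_eq₂ : ∀ x y : M, y ⊕ₘ (tilde y ⊙ₘ x) = (x ⊙ₘ minus y) ⊕ₘ y
  sup_eq₃ : ∀ x y : M, (x ⊙ₘ minus y) ⊕ₘ y = (y ⊙ₘ minus x) ⊕ₘ x
  inf_eq : ∀ x y : M, x ⊙ₘ (minus x ⊕ₘ y) = (x ⊕ₘ tilde y) ⊙ₘ y
  tilde_minus : ∀ x : M, tilde (minus x) = x

namespace PseudoMVAlgebra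

open PseudoMVOps

/-- The join `x ∨ y = x ⊕ (x^∼ ⊙ y)`. -/
def join {M : Type*} [PseudoMVAlgebra M] (x y : M) : M := x ⊕ₘ (tilde x ⊙ₘ y)

/-- The lattice order of a pseudo MV-algebra: `x ≤ y` iff `x ∨ y = y`. -/
def le {M : Type*} [PseudoMVAlgebra M] (x y : M) : Prop := join x y = y

/-- `x → y = x⁻ ⊕ y`. -/
def arrow {M : Type*} [PseudoMVAlgebra M] (x y : M) : M := minus x ⊕ₘ y

/-- `x ⇝ y = y ⊕ x^∼`. -/
def squigArrow {M : Type*} [PseudoMVAlgebra M] (x y : M) : M := y ⊕ₘ tilde x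

/-- The pseudo MV-algebra `M` is linearly ordered. -/
def IsLinearlyOrdered (M : Type*) [PseudoMVAlgebra M] : Prop :=
  ∀ x y : M, le x y ∨ le y x

/-- The pseudo MV-algebra `M` is symmetric: the two negations coincide. -/
def IsSymmetric (M : Type*) [PseudoMVAlgebra M] : Prop :=
  ∀ x : M, tilde x = minus x

/-- Homomorphisms of pseudo MV-algebras. -/
structure IsHom {M N : Type*} [PseudoMVAlgebra M] [PseudoMVAlgebra N] (f : M → N) : Prop where
  map_oplus : ∀ x y : M, f (x ⊕ₘ y) = f x ⊕ₘ f y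
  map_minus : ∀ x : M, f (minus x) = minus (f x)
  map_tilde : ∀ x : M, f (tilde x) = tilde (f x)
  map_zero : f zero = zero
  map_one : f one = one

/-- The direct product of a family of pseudo MV-algebras, with the componentwise operations. -/
instance instPi {I : Type*} (N : I → Type*) [∀ i, PseudoMVAlgebra (N i)] :
    PseudoMVAlgebra (∀ i, N i) where
  oplus x y := fun i => x i ⊕ₘ y i
  minus x := fun i => minus (x i)
  tilde x := fun i => tilde (x i)
  zero := fun _ => zero
  one := fun _ => one
  oplus_assoc _ _ _ := funext fun _ => oplus_assoc _ _ _
  oplus_zero _ := funext fun _ => oplus_zero _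
  zero_oplus _ := funext fun _ => zero_oplus _
  oplus_one _ := funext fun _ => oplus_one _
  one_oplus _ := funext fun _ => one_oplus _
  minus_one := funext fun _ => minus_one
  tilde_one := funext fun _ => tilde_one
  tilde_minus_oplus_minus _ _ := funext fun _ => tilde_minus_oplus_minus _ _
  sup_eq₁ _ _ := funext fun _ => sup_eq₁ _ _
  sup_eq₂ _ _ := funext fun _ => sup_eq₂ _ _
  sup_eq₃ _ _ := funext fun _ => sup_eq₃ _ _
  inf_eq _ _ := funext fun _ => inf_eq _ _
  tilde_minus _ := funext fun _ => tilde_minus _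

/-- `M` is representable: it is a subdirect product of linearly ordered pseudo MV-algebras, that
is, it embeds into a direct product of such algebras with all projections onto the factors
surjective. (The factors are quotients of `M` and distinct congruences suffice as indices, so
taking both in the universe of `M` is no restriction.) -/
def IsRepresentable.{v} (M : Type v) [PseudoMVAlgebra M] : Prop :=
  ∃ (I : Type v) (N : I → Type v) (_ : ∀ i, PseudoMVAlgebra (N i)) (f : M → ∀ i, N i),
    (∀ i, IsLinearlyOrdered (N i)) ∧ IsHom f ∧ Function.Injective f ∧
      ∀ i, Function.Surjective fun x => f x i

/-- `r` is a square root on the pseudo MV-algebra `M`. -/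
structure IsSquareRoot {M : Type*} [PseudoMVAlgebra M] (r : M → M) : Prop where
  odot_self : ∀ x : M, r x ⊙ₘ r x = x
  le_of_odot_le : ∀ x y : M, le (y ⊙ₘ y) x → le y (r x)
  map_minus : ∀ x : M, r (minus x) = arrow (r x) (r zero)
  map_tilde : ∀ x : M, r (tilde x) = squigArrow (r x) (r zero)

/-- `r` is a strict square root: a square root with `r(0) = r(0)⁻`. -/
structure IsStrictSquareRoot {M : Type*} [PseudoMVAlgebra M] (r : M → M) : Prop
    extends IsSquareRoot r where
  strict : r zero = minus (r zero)

end PseudoMVAlgebra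

/-- `u` is a strong unit of the (not necessarily commutative) `ℓ`-group `G`. -/
structure IsStrongUnit {G : Type*} [AddGroup G] [Lattice G] (u : G) : Prop where
  nonneg : 0 ≤ u
  exists_le_nsmul : ∀ g : G, ∃ n : ℕ, 1 ≤ n ∧ g ≤ n • u

/-- The underlying set `[0, u]` of `Γ(G, u)`. -/
def Gamma {G : Type*} [AddGroup G] [Lattice G] (u : G) (_hu : IsStrongUnit u) : Type _ :=
  {x : G // 0 ≤ x ∧ x ≤ u}

namespace Gamma

open PseudoMVOps

/-- The element of `G` underlying an element of `Γ(G, u)`. -/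
def val {G : Type*} [AddGroup G] [Lattice G] {u : G} {hu : IsStrongUnit u}
    (x : Gamma u hu) : G := Subtype.val x

theorem ext {G : Type*} [AddGroup G] [Lattice G] {u : G} {hu : IsStrongUnit u}
    {x y : Gamma u hu} (h : x.val = y.val) : x = y := Subtype.ext h

theorem val_nonneg {G : Type*} [AddGroup G] [Lattice G] {u : G} {hu : IsStrongUnit u}
    (x : Gamma u hu) : 0 ≤ x.val := x.2.1

theorem val_le {G : Type*} [AddGroup G] [Lattice G] {u : G} {hu : IsStrongUnit u}
    (x : Gamma u hu) : x.val ≤ u := x.2.2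

/-- The operations of `Γ(G, u)`: `x ⊕ y = (x + y) ∧ u`, `x⁻ = u - x`, `x^∼ = -x + u`. -/
instance instOps {G : Type*} [AddGroup G] [Lattice G] [AddLeftMono G] [AddRightMono G]
    (u : G) (hu : IsStrongUnit u) : PseudoMVOps (Gamma u hu) where
  oplus x y := ⟨(x.val + y.val) ⊓ u,
    le_inf (add_nonneg x.val_nonneg y.val_nonneg) hu.nonneg, inf_le_right⟩
  minus x := ⟨u - x.val, sub_nonneg.2 x.val_le, sub_le_self u x.val_nonneg⟩
  tilde x := ⟨-x.val + u, by simpa using x.val_le, by simpa using x.val_nonneg⟩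
  zero := ⟨0, le_rfl, hu.nonneg⟩
  one := ⟨u, hu.nonneg, le_rfl⟩

section

variable {G : Type*} [AddGroup G] [Lattice G] [AddLeftMono G] [AddRightMono G]
  {u : G} {hu : IsStrongUnit u}

theorem val_oplus (x y : Gamma u hu) : (x ⊕ₘ y).val = (x.val + y.val) ⊓ u := rfl

theorem val_minus (x : Gamma u hu) : (minus x).val = u - x.val := rfl

theorem val_tilde (x : Gamma u hu) : (tilde x).val = -x.val + u := rfl

theorem val_zero : (zero : Gamma u hu).val = 0 := rfl

theorem val_one : (one : Gamma u hu).val = u := rfl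

/-- In `Γ(G, u)`, `x ⊙ y = (x - u + y) ∨ 0`. -/
theorem val_odot (x y : Gamma u hu) : (x ⊙ₘ y).val = (x.val - u + y.val) ⊔ 0 := by
  simp only [odot, val_tilde, val_oplus, val_minus, neg_inf, sup_add, neg_add_rev, neg_sub,
    neg_add_cancel]
  congr 1
  simp [sub_eq_add_neg, add_assoc]

theorem val_sup₁ (x y : Gamma u hu) : (x ⊕ₘ (tilde x ⊙ₘ y)).val = x.val ⊔ y.val := by
  have h : x.val + ((-x.val + u - u + y.val) ⊔ 0) = x.val ⊔ y.val := by
    rw [add_sup]; simp [sup_comm]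
  rw [val_oplus, val_odot, val_tilde, h]
  exact inf_eq_left.2 (sup_le x.val_le y.val_le)

theorem val_sup₂ (x y : Gamma u hu) : ((x ⊙ₘ minus y) ⊕ₘ y).val = x.val ⊔ y.val := by
  have h : ((x.val - u + (u - y.val)) ⊔ 0) + y.val = x.val ⊔ y.val := by
    rw [sup_add]; simp
  rw [val_oplus, val_odot, val_minus, h]
  exact inf_eq_left.2 (sup_le x.val_le y.val_le)

theorem val_inf₁ (x y : Gamma u hu) : (x ⊙ₘ (minus x ⊕ₘ y)).val = x.val ⊓ y.val := by
  have h : x.val - u + ((u - x.val + y.val) ⊓ u) = x.val ⊓ y.val := by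
    rw [add_inf]; simp [sub_eq_add_neg, add_assoc, inf_comm]
  rw [val_odot, val_oplus, val_minus, h]
  exact sup_eq_left.2 (le_inf x.val_nonneg y.val_nonneg)

theorem val_inf₂ (x y : Gamma u hu) : ((x ⊕ₘ tilde y) ⊙ₘ y).val = x.val ⊓ y.val := by
  have h : ((x.val + (-y.val + u)) ⊓ u) - u + y.val = x.val ⊓ y.val := by
    rw [sub_eq_add_neg, inf_add, inf_add]; simp [add_assoc]
  rw [val_odot, val_oplus, val_tilde, h]
  exact sup_eq_left.2 (le_inf x.val_nonneg y.val_nonneg)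

end

/-- The pseudo MV-algebra `Γ(G, u)` of a unital `ℓ`-group `(G, u)`. -/
instance instPseudoMVAlgebra {G : Type*} [AddGroup G] [Lattice G] [AddLeftMono G]
    [AddRightMono G] (u : G) (hu : IsStrongUnit u) : PseudoMVAlgebra (Gamma u hu) where
  oplus_assoc x y z := by
    apply ext
    simp only [val_oplus, add_inf, inf_add]
    rw [inf_assoc, inf_assoc, inf_eq_right.2 (le_add_of_nonneg_left x.val_nonneg),
      inf_eq_right.2 (le_add_of_nonneg_right z.val_nonneg), add_assoc]
  oplus_zero x := ext <| by
    rw [val_oplus, val_zero, add_zero]; exact inf_eq_left.2 x.val_le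
  zero_oplus x := ext <| by
    rw [val_oplus, val_zero, zero_add]; exact inf_eq_left.2 x.val_le
  oplus_one x := ext <| by
    rw [val_oplus, val_one]; exact inf_eq_right.2 (le_add_of_nonneg_left x.val_nonneg)
  one_oplus x := ext <| by
    rw [val_oplus, val_one]; exact inf_eq_right.2 (le_add_of_nonneg_right x.val_nonneg)
  minus_one := ext <| by rw [val_minus, val_one, val_zero, sub_self]
  tilde_one := ext <| by rw [val_tilde, val_one, val_zero, neg_add_cancel]
  tilde_minus_oplus_minus x y := by
    apply ext
    change (y ⊙ₘ x).val = _
    rw [val_odot, val_minus, val_oplus, val_tilde, val_tilde, sub_eq_add_neg u (_ ⊓ _), neg_inf,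
      add_sup]
    congr 1
    · simp [sub_eq_add_neg, add_assoc]
    · simp
  sup_eq₁ x y := ext <| by rw [val_sup₁, val_sup₁, sup_comm]
  sup_eq₂ x y := ext <| by rw [val_sup₁, val_sup₂, sup_comm]
  sup_eq₃ x y := ext <| by rw [val_sup₂, val_sup₂, sup_comm]
  inf_eq x y := ext <| by rw [val_inf₁, val_inf₂]
  tilde_minus x := ext <| by rw [val_tilde, val_minus]; simp

end Gamma

/-- `h = g / 2` in the group `G`: `h` is the unique element with `h + h = g`. -/
def IsHalf {G : Type*} [AddGroup G] (g h : G) : Prop :=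
  h + h = g ∧ ∀ k : G, k + k = g → k = h

section LatticeOrderedGroup

variable {G : Type*} [AddGroup G] [Lattice G] [AddLeftMono G] [AddRightMono G]

/-! Symmetry says that `u` commutes with every element of `[0, u]`, and strictness says that `r(0)`
is half of `u`. Since `r(0) ≤ r(x)`, the truncation in `r(x) ⊙ r(x) = x` is inactive, and the
equation becomes `r(x) + r(x) = x + u`. Uniqueness is the delicate part, as halves need not be
unique in a noncommutative `ℓ`-group. Any `k` with `k + k = x + u` lies in `[0, u]`
(`mem_Icc_of_add_self_eq`) and satisfies `k ⊙ k = x`, so `k ≤ r(x)` by maximality of the square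
root. Comparable elements with equal doubles coincide (`eq_of_le_of_add_self_eq`). -/

theorem nonneg_of_add_self_nonneg {k : G} (h : 0 ≤ k + k) : 0 ≤ k := by
  -- Expanding gives the meet of `k + k`, `k` and `0`, where `k + k` is absorbed by `0`. An
  -- idempotent of a group is `0`.
  have h₁ : k ⊓ 0 + k ⊓ 0 = k ⊓ 0 := by
    rw [add_inf, inf_add, inf_add, zero_add, add_zero, add_zero]
    apply le_antisymm inf_le_right
    exact le_inf (le_inf (inf_le_right.trans h) inf_le_left) le_rfl
  exact inf_eq_right.1 (add_eq_left.1 h₁)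

/-- If `u` commutes with `k ⊓ u`, then `k + k ≤ u + u` forces `k ≤ u`. -/
theorem le_of_add_self_le_of_commute_inf {k u : G} (h : k + k ≤ u + u)
    (hc : AddCommute u (k ⊓ u)) : k ≤ u := by
  have hc' : (u + k) ⊓ (u + u) = (k + u) ⊓ (u + u) := by
    rw [← add_inf, ← inf_add]; exact hc
  -- The left side is the meet of the four sums of `k` and `u`. By `hc'`, `u + k` may be replaced by
  -- `k + u`, and `u + u` is absorbed by `k + k`; what remains is the right side.
  have h₁ : k ⊓ u + k ⊓ u = k + k ⊓ u := by
    rw [inf_add, add_inf, add_inf, hc', ← inf_assoc, inf_assoc (k + k), inf_idem]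
    apply inf_eq_left.2
    exact inf_le_left.trans h
  exact inf_eq_left.1 (add_right_cancel h₁)

theorem eq_of_le_of_add_self_eq {k a : G} (hle : k ≤ a) (h : k + k = a + a) : k = a := by
  apply le_antisymm hle
  have h₁ : a + a ≤ k + a := h ▸ add_le_add_right hle k
  exact le_of_add_le_add_right h₁

end LatticeOrderedGroup

namespace Gamma

open PseudoMVOps PseudoMVAlgebra

variable {G : Type*} [AddGroup G] [Lattice G] [AddLeftMono G] [AddRightMono G]
  {u : G} {hu : IsStrongUnit u}

theorem le_iff_val_le {x y : Gamma u hu} : PseudoMVAlgebra.le x y ↔ x.val ≤ y.val := by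
  have h : (join x y).val = x.val ⊔ y.val := val_sup₁ x y
  exact ⟨fun hxy => sup_eq_right.1 (h.symm.trans (congrArg val hxy)),
    fun hxy => ext (h.trans (sup_eq_right.2 hxy))⟩

theorem addCommute_val (hsymm : IsSymmetric (Gamma u hu)) (x : Gamma u hu) :
    AddCommute u x.val := by
  have h : -x.val + u = u - x.val := congrArg val (hsymm x)
  have h' : AddCommute u (-x.val) := by
    rw [AddCommute, AddSemiconjBy, h, sub_eq_add_neg]
  simpa using h'.neg_right

/-- Square of an element above the half of the unit. -/
theorem val_odot_self_of_le (hsymm : IsSymmetric (Gamma u hu)) {a : Gamma u hu}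
    (ha : u ≤ a.val + a.val) : (a ⊙ₘ a).val + u = a.val + a.val := by
  have hc := addCommute_val hsymm a
  have h : a.val - u + a.val = a.val + a.val - u := by
    rw [sub_eq_add_neg, sub_eq_add_neg, add_assoc, add_assoc, hc.neg_left.eq]
  rw [val_odot, h, sup_eq_left.2 (sub_nonneg.2 ha), sub_add_cancel]

/-- `r(0) ⊙ r(0) = 0 ≤ x` forces `r(0) ≤ r(x)`, and `r(0)` doubles to `u` by strictness. -/
theorem le_add_self_of_isStrictSquareRoot {r : Gamma u hu → Gamma u hu}
    (hr : IsStrictSquareRoot r) (x : Gamma u hu) : u ≤ (r x).val + (r x).val := by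
  have h₀ : (r zero).val + (r zero).val = u := by
    have h : (r zero).val = u - (r zero).val := congrArg val hr.strict
    exact eq_sub_iff_add_eq.1 h
  have h₁ : (r zero).val ≤ (r x).val := by
    refine le_iff_val_le.1 (hr.le_of_odot_le _ _ (le_iff_val_le.2 ?_))
    rw [hr.odot_self]
    exact x.val_nonneg
  exact h₀.ge.trans (add_le_add h₁ h₁)

theorem mem_Icc_of_add_self_eq (hsymm : IsSymmetric (Gamma u hu)) (x : Gamma u hu) {k : G}
    (hk : k + k = x.val + u) : 0 ≤ k ∧ k ≤ u := by
  have h₀ : 0 ≤ k :=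
    nonneg_of_add_self_nonneg (hk ▸ add_nonneg x.val_nonneg hu.nonneg)
  -- Symmetry says nothing about `k` before `k ≤ u` is known, but it applies to the truncation `k ⊓
  -- u`, whose commuting with `u` suffices.
  let m : Gamma u hu := ⟨k ⊓ u, le_inf h₀ hu.nonneg, inf_le_right⟩
  have hle : k + k ≤ u + u := hk ▸ add_le_add_left x.val_le u
  exact ⟨h₀, le_of_add_self_le_of_commute_inf hle (addCommute_val hsymm m)⟩

end Gamma

theorem theorem7p2 {G : Type*} [AddGroup G] [Lattice G] [AddLeftMono G] [AddRightMono G]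
    (u : G) (hu : IsStrongUnit u)
    (hrep : PseudoMVAlgebra.IsRepresentable (Gamma u hu))
    (hsymm : PseudoMVAlgebra.IsSymmetric (Gamma u hu))
    (r : Gamma u hu → Gamma u hu) (hr : PseudoMVAlgebra.IsStrictSquareRoot r) :
    ∀ x : Gamma u hu, ∃ h : G, IsHalf (x.val + u) h ∧ (r x).val = h := by
  intro x
  have hdouble : (r x).val + (r x).val = x.val + u := by
    rw [← Gamma.val_odot_self_of_le hsymm (Gamma.le_add_self_of_isStrictSquareRoot hr x),
      hr.odot_self]
  refine ⟨_, ⟨hdouble, fun k hk => ?_⟩, rfl⟩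
  let b : Gamma u hu := ⟨k, Gamma.mem_Icc_of_add_self_eq hsymm x hk⟩
  have hb : b.val + b.val = x.val + u := hk
  have hsq : PseudoMVOps.odot b b = x := by
    apply Gamma.ext
    apply add_right_cancel (b := u)
    rw [Gamma.val_odot_self_of_le hsymm (hb ▸ le_add_of_nonneg_left x.val_nonneg), hb]
  -- Maximality of `r(x)` supplies the comparability that uniqueness of halves requires.
  have hle : b.val ≤ (r x).val := by
    refine Gamma.le_iff_val_le.1 (hr.le_of_odot_le _ _ (Gamma.le_iff_val_le.2 ?_))
    rw [hsq]
  exact eq_of_le_of_add_self_eq hle (hk.trans hdouble.symm)
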